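/- A tense algebra is a Boolean algebra $\mathfrak A$ with operations $\square_F,\lozenge_P$ such that $\square_F$ is an interior operator ($\square_F 1=1$, $\square_F(a\wedge b)=\square_F a\wedge\square_F b$, $\square_F a\le a$, $\square_F a\le\square_F\square_F a$), $\lozenge_P$ is a closure operator ($\lozenge_P 0=0$, $\lozenge_P(a\vee b)=\lozenge_P a\vee\lozenge_P b$, $a\le\lozenge_P a$, $\lozenge_P\lozenge_P a\le\lozenge_P a$), and $\lozenge_P a\le b\iff a\le\square_F b$. Write $a\to b:=\neg a\vee b$. Let $\mathsf{GRZ.T}$ be the class of tense algebras in which, for all $a$, $$\square_F(\square_F(a\to\square_F a)\to a)\le a\quad\text{and}\quad a\le\lozenge_P\bigl(a\wedge\neg\lozenge_P(\lozenge_P a\wedge\neg a)\bigr).$$ For a tense algebra $\mathfrak A$, let $\rho\mathfrak A$ be the bi-Heyting algebra of its open elements $O(A)=\{a:\square_F a=a\}=\{a:\lozenge_P a=a\}$, with the lattice operations of $\mathfrak A$, implication $\square_F(\neg a\vee b)$ and co-implication $a\leftarrow b:=\lozenge_P(a\wedge\neg b)$. For a bi-Heyting algebra $\mathfrak H$, let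 $\sigma\mathfrak H$ be the tense algebra consisting of the free Boolean extension $B(\mathfrak H)$ with $\square_F a=\bigvee\{b\in H:b\le a\}$ and $\lozenge_P a=\bigwedge\{b\in H:a\le b\}$. A tense rule $\Gamma/\Delta$ is a pair of finite sets of formulae in $\wedge,\vee,\neg,\square_F,\lozenge_P,\bot,\top$ over a countably infinite set of variables; it is valid on $\mathfrak A$, written $\mathfrak A\models\Gamma/\Delta$, if every valuation in $\mathfrak A$ giving all members of $\Gamma$ the value $1$ gives some member of $\Delta$ the value $1$. A universal class of tense algebras is one axiomatised, within tense algebras, by universal first-order sentences. For a universal class $\mathcal U$ of tense algebras put $\rho\,\mathcal U=\{\rho\mathfrak A:\mathfrak A\in\mathcal U\}$, and for a class $\mathcal V$ of bi-Heyting algebras let $\sigma\mathcal V$ be the least universal class of tense algebras containing all $\sigma\mathfrak H$, $\mathfrak H\in\mathcal V$. Theorem. (1) For every $\mathfrak A\in\mathsf{GRZ.T}$ and every tense rule $\Gamma/\Delta$: $\mathfrak A\models\Gamma/\Delta$ if and only if $\sigma\rho\mathfrak A\models\Gamma/\Delta$. (2) Every universal class $\mathcal U\subseteq\mathsf{GRZ.T}$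 is generated by its skeletal elements $\sigma\rho\mathfrak A$ ($\mathfrak A\in\mathcal U$), i.e. $\mathcal U=\sigma\rho\,\mathcal U$. -/

import Mathlib

universe u

/-! ## Tense algebras -/

/-- A tense algebra: a Boolean algebra with an interior operator `boxF` and a closure operator
`diaP` which form a residual pair. -/
class TenseAlgebra (A : Type u) extends BooleanAlgebra A where
  /-- the forward-looking box -/
  boxF : A → A
  /-- the backward-looking diamond -/
  diaP : A → A
  boxF_top : boxF ⊤ = ⊤
  boxF_inf (a b : A) : boxF (a ⊓ b) = boxF a ⊓ boxF b
  boxF_le (a : A) : boxF a ≤ a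
  boxF_le_boxF_boxF (a : A) : boxF a ≤ boxF (boxF a)
  diaP_bot : diaP ⊥ = ⊥
  diaP_sup (a b : A) : diaP (a ⊔ b) = diaP a ⊔ diaP b
  le_diaP (a : A) : a ≤ diaP a
  diaP_diaP_le (a : A) : diaP (diaP a) ≤ diaP a
  diaP_le_iff_le_boxF (a b : A) : diaP a ≤ b ↔ a ≤ boxF b

open TenseAlgebra (boxF diaP)

/-- The class `Ten` of all tense algebras (with carrier in `Type u`), as a type. -/
structure Ten : Type (u + 1) where
  carrier : Type u
  [str : TenseAlgebra carrier]

instance : CoeSort Ten.{u} (Type u) := ⟨Ten.carrier⟩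

instance (A : Ten.{u}) : TenseAlgebra A := A.str

/-- The class `bi-HA` of all bi-Heyting algebras (with carrier in `Type u`), as a type. In a
`BiheytingAlgebra`, implication is written `a ⇨ b` and co-implication `a \ b`. -/
structure BiHA : Type (u + 1) where
  carrier : Type u
  [str : BiheytingAlgebra carrier]

instance : CoeSort BiHA.{u} (Type u) := ⟨BiHA.carrier⟩

instance (H : BiHA.{u}) : BiheytingAlgebra H := H.str

/-- The class `GRZ.T`: the tense algebras validating the Grzegorczyk axioms for both operators,
`□_F(□_F(p → □_F p) → p) → p` and `p → ◇_P(p ∧ ¬◇_P(◇_P p ∧ ¬p))`. -/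
def GRZT : Set Ten.{u} :=
  {A | ∀ a : A,
    boxF ((boxF (aᶜ ⊔ boxF a))ᶜ ⊔ a) ≤ a ∧
    a ≤ diaP (a ⊓ (diaP (diaP a ⊓ aᶜ))ᶜ)}

/-! ## The tense signature, tense formulae and tense rules -/

/-- The operation symbols of the tense signature. -/
inductive TenseOp : ℕ → Type
  | and : TenseOp 2
  | or : TenseOp 2
  | not : TenseOp 1
  | boxF : TenseOp 1
  | diaP : TenseOp 1
  | bot : TenseOp 0
  | top : TenseOp 0

/-- The tense signature, an algebraic signature (it has no relation symbols but equality). -/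
def tenseSig : FirstOrder.Language := ⟨TenseOp, fun _ => Empty⟩

/-- Every tense algebra is an algebra in the tense signature. -/
instance (A : Type u) [TenseAlgebra A] : tenseSig.Structure A where
  funMap {_} f := match f with
    | TenseOp.and => fun x => x 0 ⊓ x 1
    | TenseOp.or => fun x => x 0 ⊔ x 1
    | TenseOp.not => fun x => (x 0)ᶜ
    | TenseOp.boxF => fun x => boxF (x 0)
    | TenseOp.diaP => fun x => diaP (x 0)
    | TenseOp.bot => fun _ => ⊥
    | TenseOp.top => fun _ => ⊤
  RelMap {_} r := nomatch r

/-- Tense formulae over a countably infinite set of propositional variables: the terms of the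
tense signature. -/
abbrev TenseFormula : Type := tenseSig.Term ℕ

/-- A tense (multi-conclusion) rule `Γ/Δ`. -/
structure TenseRule : Type where
  premises : Finset TenseFormula
  conclusions : Finset TenseFormula

/-- `Γ/Δ` is valid on `A`: every valuation giving all premises the value `1` gives some
conclusion the value `1`. -/
def TenseRule.ValidOn (r : TenseRule) (A : Ten.{u}) : Prop :=
  ∀ V : ℕ → A, (∀ γ ∈ r.premises, γ.realize V = ⊤) → ∃ δ ∈ r.conclusions, δ.realize V = ⊤

/-! ## Universal classes -/

/-- A universal class of tense algebras: one axiomatised, within tense algebras, by a set of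
universal first-order sentences. -/
def IsUniversalClass (U : Set Ten.{u}) : Prop :=
  ∃ T : tenseSig.Theory, T.IsUniversal ∧ U = {A : Ten.{u} | A.carrier ⊨ T}

/-- `Uni K`: the least universal class containing `K`. -/
def Uni (K : Set Ten.{u}) : Set Ten.{u} :=
  ⋂₀ {U | IsUniversalClass U ∧ K ⊆ U}

/-- `Uni K` is itself a universal class. -/
theorem isUniversalClass_Uni (K : Set Ten.{u}) : IsUniversalClass (Uni K) := by
  refine ⟨{φ | φ.IsUniversal ∧ ∀ A ∈ K, A.carrier ⊨ φ}, ⟨fun _ h => h.1⟩, ?_⟩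
  ext A
  constructor
  · intro h
    exact h _ ⟨⟨_, ⟨fun _ h => h.1⟩, rfl⟩, fun B hB => ⟨fun φ hφ => hφ.2 B hB⟩⟩
  · rintro h _ ⟨⟨T, hT, rfl⟩, hK⟩
    exact ⟨fun φ hφ => h.realize_of_mem φ ⟨hT.1 hφ, fun B hB => (hK hB).realize_of_mem φ hφ⟩⟩

/-! ## The bi-Heyting algebra of open elements -/

section Rho

variable {A : Type u} [TenseAlgebra A]

theorem TenseAlgebra.boxF_mono {a b : A} (h : a ≤ b) : boxF a ≤ boxF b := by
  have := boxF_inf a b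
  rw [inf_eq_left.2 h] at this
  rw [this]
  exact inf_le_right

theorem TenseAlgebra.diaP_mono {a b : A} (h : a ≤ b) : diaP a ≤ diaP b := by
  have := diaP_sup a b
  rw [sup_eq_right.2 h] at this
  rw [this]
  exact le_sup_left

theorem TenseAlgebra.boxF_eq_self_iff {a : A} : boxF a = a ↔ a ≤ boxF a :=
  ⟨fun h => h.ge, fun h => le_antisymm (boxF_le a) h⟩

/-- The two descriptions of the open elements agree. -/
theorem TenseAlgebra.boxF_eq_self_iff_diaP {a : A} : boxF a = a ↔ diaP a = a := by
  rw [boxF_eq_self_iff, ← diaP_le_iff_le_boxF]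
  exact ⟨fun h => le_antisymm h (le_diaP a), fun h => h.le⟩

theorem TenseAlgebra.boxF_boxF (a : A) : boxF (boxF a) = boxF a :=
  le_antisymm (boxF_le _) (boxF_le_boxF_boxF a)

theorem TenseAlgebra.boxF_diaP (a : A) : boxF (diaP a) = diaP a :=
  boxF_eq_self_iff_diaP.2 (le_antisymm (diaP_diaP_le a) (le_diaP _))

variable (A) in
/-- The set `O(A)` of open elements. -/
def OpenElt : Type u := {a : A // boxF a = a}

namespace OpenElt

open TenseAlgebra

instance : PartialOrder (OpenElt A) := inferInstanceAs (PartialOrder {a : A // boxF a = a})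

instance : Lattice (OpenElt A) where
  sup a b := ⟨a.1 ⊔ b.1, by
    rw [boxF_eq_self_iff_diaP, diaP_sup, boxF_eq_self_iff_diaP.1 a.2,
      boxF_eq_self_iff_diaP.1 b.2]⟩
  inf a b := ⟨a.1 ⊓ b.1, by rw [boxF_inf, a.2, b.2]⟩
  le_sup_left a b := le_sup_left (a := a.1) (b := b.1)
  le_sup_right a b := le_sup_right (a := a.1) (b := b.1)
  sup_le a b c h h' := sup_le (a := a.1) (b := b.1) (c := c.1) h h'
  inf_le_left a b := inf_le_left (a := a.1) (b := b.1)
  inf_le_right a b := inf_le_right (a := a.1) (b := b.1)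
  le_inf _ _ _ h h' := _root_.le_inf h h'

instance : BiheytingAlgebra (OpenElt A) where
  top := ⟨⊤, boxF_top⟩
  le_top a := le_top (a := a.1)
  bot := ⟨⊥, le_bot_iff.1 (boxF_le ⊥)⟩
  bot_le a := bot_le (a := a.1)
  himp a b := ⟨boxF (a.1ᶜ ⊔ b.1), boxF_boxF _⟩
  le_himp_iff a b c := by
    change a.1 ≤ boxF (b.1ᶜ ⊔ c.1) ↔ a.1 ⊓ b.1 ≤ c.1
    rw [← diaP_le_iff_le_boxF, boxF_eq_self_iff_diaP.1 a.2, sup_comm, ← himp_eq, le_himp_iff]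
  compl a := ⟨boxF (a.1ᶜ), boxF_boxF _⟩
  himp_bot a := Subtype.ext (congrArg boxF (sup_bot_eq (a.1ᶜ)))
  sdiff a b := ⟨diaP (a.1 ⊓ b.1ᶜ), boxF_diaP _⟩
  sdiff_le_iff a b c := by
    change diaP (a.1 ⊓ b.1ᶜ) ≤ c.1 ↔ a.1 ≤ b.1 ⊔ c.1
    rw [diaP_le_iff_le_boxF, c.2, ← sdiff_eq, sdiff_le_iff]
  hnot a := ⟨diaP (a.1ᶜ), boxF_diaP _⟩
  top_sdiff a := Subtype.ext (congrArg diaP (top_inf_eq (a.1ᶜ)))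

end OpenElt

end Rho

/-- `ρ A`, the bi-Heyting algebra of open elements of `A`. -/
def rho (A : Ten.{u}) : BiHA.{u} := ⟨OpenElt A⟩

/-! ## The free Boolean extension -/

section Sigma

variable (H : Type u) [BiheytingAlgebra H]

/-- The prime (proper) ideals of `H`. -/
def PrimeIdl : Type u := {I : Order.Ideal H // I.IsPrime}

variable {H} in
/-- The Stone embedding of `H` into the powerset of its set of prime ideals. -/
def stone (h : H) : Set (PrimeIdl H) := {I | h ∉ I.1}

/-- The free Boolean extension `B(H)`: the Boolean algebra generated by (the Stone copy of) the
bounded distributive lattice `H`. -/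
def FreeBoolExt : Type u :=
  ↥(BooleanSubalgebra.closure (Set.range (stone (H := H))))

instance : BooleanAlgebra (FreeBoolExt H) :=
  inferInstanceAs (BooleanAlgebra ↥(BooleanSubalgebra.closure (Set.range (stone (H := H)))))

variable {H}

/-- The inclusion of `H` into `B(H)`. -/
def FreeBoolExt.incl (h : H) : FreeBoolExt H :=
  ⟨stone h, BooleanSubalgebra.subset_closure ⟨h, rfl⟩⟩

theorem stone_inf (a b : H) : stone (a ⊓ b) = stone a ∩ stone b := by
  ext I
  have hI := I.2
  change a ⊓ b ∉ I.1 ↔ a ∉ I.1 ∧ b ∉ I.1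
  rw [← not_or, not_iff_not]
  exact ⟨fun h => hI.mem_or_mem h,
    fun h => h.elim (I.1.lower inf_le_left) (I.1.lower inf_le_right)⟩

theorem stone_sup (a b : H) : stone (a ⊔ b) = stone a ∪ stone b := by
  ext I
  change a ⊔ b ∉ I.1 ↔ a ∉ I.1 ∨ b ∉ I.1
  rw [Order.Ideal.sup_mem_iff, not_and_or]

theorem stone_bot : stone (⊥ : H) = ∅ := by
  ext I
  change ⊥ ∉ I.1 ↔ False
  simp

theorem stone_top : stone (⊤ : H) = Set.univ := by
  ext I
  have hI := I.2.toIsProper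
  change ⊤ ∉ I.1 ↔ True
  simp only [iff_true]
  exact hI.top_notMem

theorem stone_subset_iff {a b : H} : stone a ⊆ stone b ↔ a ≤ b := by
  constructor
  · intro h
    by_contra hab
    have hd : Disjoint (Order.PFilter.principal a : Set H) (Order.Ideal.principal b : Set H) := by
      rw [Set.disjoint_left]
      intro x hx hx'
      exact hab (le_trans (Order.PFilter.mem_principal.1 hx) (Order.Ideal.mem_principal.1 hx'))
    obtain ⟨J, hJ, hbJ, haJ⟩ := DistribLattice.prime_ideal_of_disjoint_filter_ideal hd
    have h1 : (⟨J, hJ⟩ : PrimeIdl H) ∈ stone a := fun haJ' =>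
      Set.disjoint_left.1 haJ (Order.PFilter.mem_principal.2 le_rfl) haJ'
    exact h h1 (hbJ (Order.Ideal.mem_principal.2 le_rfl))
  · intro h I ha hb
    exact ha (I.1.lower h hb)

theorem isSublattice_range_stone : IsSublattice (Set.range (stone (H := H))) where
  supClosed := by
    rintro _ ⟨a, rfl⟩ _ ⟨b, rfl⟩
    exact ⟨a ⊔ b, stone_sup a b⟩
  infClosed := by
    rintro _ ⟨a, rfl⟩ _ ⟨b, rfl⟩
    exact ⟨a ⊓ b, stone_inf a b⟩

namespace FreeBoolExt

theorem incl_le_incl {a b : H} : incl a ≤ incl b ↔ a ≤ b := stone_subset_iff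

theorem incl_inf (a b : H) : incl (a ⊓ b) = incl a ⊓ incl b := Subtype.ext (stone_inf a b)

theorem incl_sup (a b : H) : incl (a ⊔ b) = incl a ⊔ incl b := Subtype.ext (stone_sup a b)

theorem incl_bot : incl (⊥ : H) = ⊥ := Subtype.ext stone_bot

theorem incl_top : incl (⊤ : H) = ⊤ := Subtype.ext stone_top

/-- Every element of `B(H)` is a finite join of differences of elements of `H`. -/
theorem sup_sdiff_induction {p : FreeBoolExt H → Prop}
    (sdiff : ∀ x y : H, p (incl x \ incl y)) (sup : ∀ a b, p a → p b → p (a ⊔ b))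
    (a : FreeBoolExt H) : p a := by
  obtain ⟨a, ha⟩ := a
  refine BooleanSubalgebra.closure_sdiff_sup_induction
    (p := fun g hg => p (⟨g, hg⟩ : FreeBoolExt H))
    isSublattice_range_stone ⟨⊥, stone_bot⟩ ⟨⊤, stone_top⟩ ?_ ?_ a ha
  · rintro _ ⟨x, rfl⟩ _ ⟨y, rfl⟩
    exact sdiff x y
  · intro x hx y hy h1 h2
    exact sup _ _ h1 h2

/-- Among the elements of `H` above `a` there is a least one. -/
theorem exists_isLeast (a : FreeBoolExt H) : ∃ h : H, IsLeast {b : H | a ≤ incl b} h := by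
  suffices h : ∃ h : H, ∀ b : H, a ≤ incl b ↔ h ≤ b by
    obtain ⟨h, hh⟩ := h
    exact ⟨h, (hh h).2 le_rfl, fun b hb => (hh b).1 hb⟩
  induction a using sup_sdiff_induction with
  | sdiff x y =>
    refine ⟨x \ y, fun b => ?_⟩
    rw [_root_.sdiff_le_iff, ← incl_sup, incl_le_incl, _root_.sdiff_le_iff]
  | sup a b iha ihb =>
    obtain ⟨h, hh⟩ := iha
    obtain ⟨k, hk⟩ := ihb
    exact ⟨h ⊔ k, fun c => by rw [sup_le_iff, sup_le_iff, hh, hk]⟩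

/-- Among the elements of `H` below `a` there is a greatest one. -/
theorem exists_isGreatest (a : FreeBoolExt H) : ∃ h : H, IsGreatest {b : H | incl b ≤ a} h := by
  suffices h : ∀ a : FreeBoolExt H, ∃ h : H, ∀ b : H, incl b ≤ aᶜ ↔ b ≤ h by
    obtain ⟨h, hh⟩ := h aᶜ
    rw [compl_compl] at hh
    exact ⟨h, (hh h).2 le_rfl, fun b hb => (hh b).1 hb⟩
  intro a
  induction a using sup_sdiff_induction with
  | sdiff x y =>
    refine ⟨x ⇨ y, fun b => ?_⟩
    rw [compl_sdiff, _root_.le_himp_iff, ← incl_inf, incl_le_incl, _root_.le_himp_iff]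
  | sup a b iha ihb =>
    obtain ⟨h, hh⟩ := iha
    obtain ⟨k, hk⟩ := ihb
    exact ⟨h ⊓ k, fun c => by rw [compl_sup, le_inf_iff, le_inf_iff, hh, hk]⟩

/-- The join, in `H`, of the elements of `H` below `a`. -/
noncomputable def interior (a : FreeBoolExt H) : H := (exists_isGreatest a).choose

/-- The meet, in `H`, of the elements of `H` above `a`. -/
noncomputable def hull (a : FreeBoolExt H) : H := (exists_isLeast a).choose

theorem le_interior_iff {a : FreeBoolExt H} {b : H} : b ≤ interior a ↔ incl b ≤ a :=
  ⟨fun h => (incl_le_incl.2 h).trans (exists_isGreatest a).choose_spec.1,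
    fun h => (exists_isGreatest a).choose_spec.2 h⟩

theorem hull_le_iff {a : FreeBoolExt H} {b : H} : hull a ≤ b ↔ a ≤ incl b :=
  ⟨fun h => (exists_isLeast a).choose_spec.1.trans (incl_le_incl.2 h),
    fun h => (exists_isLeast a).choose_spec.2 h⟩

theorem incl_interior_le (a : FreeBoolExt H) : incl (interior a) ≤ a := le_interior_iff.1 le_rfl

theorem le_incl_hull (a : FreeBoolExt H) : a ≤ incl (hull a) := hull_le_iff.1 le_rfl

/-- In `B(H)`, `incl (interior a)` is the join of the elements of `H` below `a`. -/
theorem isLUB_incl_interior (a : FreeBoolExt H) :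
    IsLUB {c : FreeBoolExt H | c ∈ Set.range (incl (H := H)) ∧ c ≤ a} (incl (interior a)) := by
  refine ⟨?_, fun c hc => hc ⟨⟨_, rfl⟩, incl_interior_le a⟩⟩
  rintro _ ⟨⟨b, rfl⟩, hb⟩
  exact incl_le_incl.2 (le_interior_iff.2 hb)

/-- In `B(H)`, `incl (hull a)` is the meet of the elements of `H` above `a`. -/
theorem isGLB_incl_hull (a : FreeBoolExt H) :
    IsGLB {c : FreeBoolExt H | c ∈ Set.range (incl (H := H)) ∧ a ≤ c} (incl (hull a)) := by
  refine ⟨?_, fun c hc => hc ⟨⟨_, rfl⟩, le_incl_hull a⟩⟩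
  rintro _ ⟨⟨b, rfl⟩, hb⟩
  exact incl_le_incl.2 (hull_le_iff.2 hb)

/-- The tense algebra `(B(H), □_F, ◇_P)`. -/
noncomputable instance : TenseAlgebra (FreeBoolExt H) where
  boxF a := incl (interior a)
  diaP a := incl (hull a)
  boxF_top := top_le_iff.1 (by
    rw [← incl_top, incl_le_incl, le_interior_iff])
  boxF_inf a b := by
    rw [← incl_inf]
    refine congrArg incl (eq_of_forall_le_iff fun c => ?_)
    rw [le_inf_iff, le_interior_iff, le_interior_iff, le_interior_iff, le_inf_iff]
  boxF_le := incl_interior_le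
  boxF_le_boxF_boxF a := incl_le_incl.2 (le_interior_iff.2 le_rfl)
  diaP_bot := le_bot_iff.1 (by
    rw [← incl_bot, incl_le_incl, hull_le_iff])
  diaP_sup a b := by
    rw [← incl_sup]
    refine congrArg incl (eq_of_forall_ge_iff fun c => ?_)
    rw [sup_le_iff, hull_le_iff, hull_le_iff, hull_le_iff, sup_le_iff]
  le_diaP := le_incl_hull
  diaP_diaP_le a := incl_le_incl.2 (hull_le_iff.2 le_rfl)
  diaP_le_iff_le_boxF _ _ :=
    ⟨fun h => hull_le_iff.1 (le_interior_iff.2 h), fun h => le_interior_iff.1 (hull_le_iff.2 h)⟩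

end FreeBoolExt

end Sigma

/-- `σ H`, the free Boolean extension of `H` with its tense operators. -/
noncomputable def sigma (H : BiHA.{u}) : Ten.{u} := ⟨FreeBoolExt H⟩

/-- `ρ` on classes of tense algebras. -/
def rhoClass (W : Set Ten.{u}) : Set BiHA.{u} := {H | ∃ A ∈ W, H = rho A}

/-- `σ` on classes of bi-Heyting algebras: the universal class generated by the `σ H`. -/
def sigmaClass (U : Set BiHA.{u}) : Set Ten.{u} := Uni {A | ∃ H ∈ U, A = sigma H}

/-! A universal sentence or a rule fails at one valuation, and that failure involves only finitely
many values. Hence if every finite subset of `A` has a local embedding into `B` (`LocallyEmbeds`),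
then `A` inherits all universal sentences and rules of `B`. Both claims follow once `A` and `σρA`
locally embed in each other.

From `σρA` to `A` there is a genuine embedding `toTense`, for every tense algebra: `B(O(A))` is the
Boolean subalgebra of `A` generated by the open elements, and its tense operators are those of `A`
restricted.

From `A` to `σρA` the Grzegorczyk axioms are needed. Take a finite partition `P` of `A` deciding the
given elements together with their values under `□_F` and `◇_P`. Each part `p` is approximated in
the skeleton from both sides. Above it lies a Boolean combination `e p` of the relevant open
elements. Below it lies `core p`, which is a Boolean combination of open elements although `p` need
not be one (`exists_toTense_eq_core`). The Grzegorczyk axioms say that from every point of `p` one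
reaches `core p` both upwards and downwards (`boxF_compl_core_le`, `le_diaP_core`).

A partition `d` of the skeleton with `core p ≤ d p ≤ e p` then exists
(`exists_pairwiseDisjoint_between`), and sending unions of parts `p` to unions of the `d p` is the
desired map. The upper bound makes it fix the relevant open elements (`supMap_eq_incl`). The lower
bound makes it commute with `□_F` and `◇_P` and be injective (`supMap_boxF`, `supMap_diaP`,
`le_of_supMap_le`). -/

/-! ## Local embeddings -/

section LocalEmbedding

/-- `g` preserves the tense operations on arguments from `F` and is injective on `F`. -/
structure IsLocalEmbedding {A B : Type u} [TenseAlgebra A] [TenseAlgebra B] (F : Set A)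
    (g : A → B) : Prop where
  map_bot : g ⊥ = ⊥
  map_top : g ⊤ = ⊤
  map_inf : ∀ a ∈ F, ∀ b ∈ F, g (a ⊓ b) = g a ⊓ g b
  map_sup : ∀ a ∈ F, ∀ b ∈ F, g (a ⊔ b) = g a ⊔ g b
  map_compl : ∀ a ∈ F, g aᶜ = (g a)ᶜ
  map_boxF : ∀ a ∈ F, g (boxF a) = boxF (g a)
  map_diaP : ∀ a ∈ F, g (diaP a) = diaP (g a)
  injOn : Set.InjOn g F

/-- Every finite part of `A` embeds in `B`. -/
def LocallyEmbeds (A B : Type u) [TenseAlgebra A] [TenseAlgebra B] : Prop :=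
  ∀ F : Set A, F.Finite → ∃ g : A → B, IsLocalEmbedding F g

variable {A B : Type u} [TenseAlgebra A] [TenseAlgebra B]

theorem IsLocalEmbedding.mono {F G : Set A} {g : A → B} (h : IsLocalEmbedding G g)
    (hFG : F ⊆ G) : IsLocalEmbedding F g where
  map_bot := h.map_bot
  map_top := h.map_top
  map_inf a ha b hb := h.map_inf a (hFG ha) b (hFG hb)
  map_sup a ha b hb := h.map_sup a (hFG ha) b (hFG hb)
  map_compl a ha := h.map_compl a (hFG ha)
  map_boxF a ha := h.map_boxF a (hFG ha)
  map_diaP a ha := h.map_diaP a (hFG ha)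
  injOn := h.injOn.mono hFG

open FirstOrder Language

theorem IsLocalEmbedding.map_funMap {F : Set A} {g : A → B} (h : IsLocalEmbedding F g) {n : ℕ}
    (f : tenseSig.Functions n) (x : Fin n → A) (hx : ∀ i, x i ∈ F) :
    Structure.funMap f (g ∘ x) = g (Structure.funMap f x) := by
  cases f with
  | and => exact (h.map_inf _ (hx 0) _ (hx 1)).symm
  | or => exact (h.map_sup _ (hx 0) _ (hx 1)).symm
  | not => exact (h.map_compl _ (hx 0)).symm
  | boxF => exact (h.map_boxF _ (hx 0)).symm
  | diaP => exact (h.map_diaP _ (hx 0)).symm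
  | bot => exact h.map_bot.symm
  | top => exact h.map_top.symm

/-- A local embedding on a suitable finite set commutes with the evaluation of a given term. -/
theorem exists_finite_realize_comp {α : Type*} (t : tenseSig.Term α) (v : α → A) :
    ∃ F : Set A, F.Finite ∧ ∀ g : A → B, IsLocalEmbedding F g →
      t.realize (g ∘ v) = g (t.realize v) := by
  induction t with
  | var i => exact ⟨∅, Set.finite_empty, fun _ _ => rfl⟩
  | func f ts ih =>
    choose F hF hg using ih
    -- The arguments of `f` must lie in the set; the value of `f` need not.
    refine ⟨Set.range (fun i => (ts i).realize v) ∪ ⋃ i, F i,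
      (Set.finite_range _).union (Set.finite_iUnion hF), fun g h => ?_⟩
    rw [Term.realize_func, Term.realize_func, ← h.map_funMap f _ fun i => Or.inl ⟨i, rfl⟩]
    refine congrArg _ (funext fun i => hg i g (h.mono ?_))
    exact (Set.subset_iUnion F i).trans Set.subset_union_right

theorem exists_finite_realize_iff {α : Type*} {n : ℕ} {φ : tenseSig.BoundedFormula α n}
    (hφ : φ.IsQF) (v : α → A) (xs : Fin n → A) :
    ∃ F : Set A, F.Finite ∧ ∀ g : A → B, IsLocalEmbedding F g →
      (φ.Realize (g ∘ v) (g ∘ xs) ↔ φ.Realize v xs) := by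
  induction hφ with
  | falsum => exact ⟨∅, Set.finite_empty, fun _ _ => Iff.rfl⟩
  | of_isAtomic h =>
    cases h with
    | equal s t =>
      obtain ⟨F, hF, hs⟩ := exists_finite_realize_comp (B := B) s (Sum.elim v xs)
      obtain ⟨G, hG, ht⟩ := exists_finite_realize_comp (B := B) t (Sum.elim v xs)
      refine ⟨{s.realize (Sum.elim v xs), t.realize (Sum.elim v xs)} ∪ (F ∪ G),
        (Set.toFinite _).union (hF.union hG), fun g h => ?_⟩
      rw [BoundedFormula.realize_bdEqual, BoundedFormula.realize_bdEqual, ← Sum.comp_elim,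
        hs g (h.mono fun _ hx => Or.inr (Or.inl hx)), ht g (h.mono fun _ hx => Or.inr (Or.inr hx))]
      exact h.injOn.eq_iff (Or.inl (Or.inl rfl)) (Or.inl (Or.inr rfl))
    | rel R => exact nomatch R
  | imp _ _ ih₁ ih₂ =>
    obtain ⟨F, hF, h₁⟩ := ih₁
    obtain ⟨G, hG, h₂⟩ := ih₂
    refine ⟨F ∪ G, hF.union hG, fun g h => ?_⟩
    rw [BoundedFormula.realize_imp, BoundedFormula.realize_imp,
      h₁ g (h.mono Set.subset_union_left), h₂ g (h.mono Set.subset_union_right)]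

/-- The local embedding is chosen only after all universal quantifiers have been instantiated by a
counterexample, so it can depend on that counterexample. This is why the valuation in `B` is merely
asserted to exist. -/
theorem LocallyEmbeds.exists_not_realize (hAB : LocallyEmbeds A B) {α : Type*} {n : ℕ}
    {φ : tenseSig.BoundedFormula α n} (hφ : φ.IsUniversal) (v : α → A) (xs : Fin n → A)
    (h : ¬φ.Realize v xs) : ∃ (w : α → B) (ys : Fin n → B), ¬φ.Realize w ys := by
  induction hφ with
  | of_isQF hφ =>
    obtain ⟨F, hF, hg⟩ := exists_finite_realize_iff (B := B) hφ v xs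
    obtain ⟨g, h'⟩ := hAB F hF
    exact ⟨g ∘ v, g ∘ xs, fun hr => h ((hg g h').1 hr)⟩
  | all _ ih =>
    rw [BoundedFormula.realize_all, not_forall] at h
    obtain ⟨x, hx⟩ := h
    obtain ⟨w, ys, hw⟩ := ih _ hx
    refine ⟨w, Fin.init ys, fun hr => hw ?_⟩
    rw [← Fin.snoc_init_self ys]
    exact hr _

theorem LocallyEmbeds.models (hAB : LocallyEmbeds A B) {T : tenseSig.Theory} (hT : T.IsUniversal)
    (hB : B ⊨ T) : A ⊨ T := by
  refine ⟨fun φ hφ => ?_⟩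
  by_contra h
  obtain ⟨w, ys, hw⟩ := hAB.exists_not_realize (hT.1 hφ) _ _ h
  refine hw ?_
  -- A sentence has no free variables, so the valuation found in `B` is the empty one.
  rw [Subsingleton.elim w default, Subsingleton.elim ys default]
  exact hB.realize_of_mem φ hφ

theorem LocallyEmbeds.validOn {A B : Ten.{u}} (hAB : LocallyEmbeds A B) {r : TenseRule}
    (hB : r.ValidOn B) : r.ValidOn A := by
  intro V hV
  choose F hF hg using fun t : TenseFormula => exists_finite_realize_comp (B := B) t V
  -- The value `⊤` and the values of the conclusions are included so that injectivity can pull a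
  -- true conclusion back to `A`.
  obtain ⟨g, h⟩ := hAB (({⊤} ∪ ⋃ t ∈ r.premises, F t) ∪
      ⋃ t ∈ r.conclusions, (F t ∪ {t.realize V})) <| by
    refine ((Set.finite_singleton _).union (r.premises.finite_toSet.biUnion fun t _ => hF t)).union
      (r.conclusions.finite_toSet.biUnion fun t _ => (hF t).union (Set.finite_singleton _))
  obtain ⟨δ, hδ, hδ'⟩ := hB (g ∘ V) fun γ hγ => by
    rw [hg γ g (h.mono fun x hx => Or.inl (Or.inr (Set.mem_biUnion hγ hx))), hV γ hγ, h.map_top]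
  refine ⟨δ, hδ, h.injOn (Or.inr (Set.mem_biUnion hδ (Or.inr rfl))) (Or.inl (Or.inl rfl)) ?_⟩
  rw [← hg δ g (h.mono fun x hx => Or.inr (Set.mem_biUnion hδ (Or.inl hx))), hδ', h.map_top]

end LocalEmbedding

/-! ## The embedding of the skeleton -/

namespace FreeBoolExt

variable {A : Type u} [TenseAlgebra A]

variable (A) in
/-- The graph of the Boolean homomorphism from `B(O(A))` to `A` extending the inclusion of
`O(A)`. -/
def skeletonGraph : BooleanSubalgebra (FreeBoolExt (OpenElt A) × A) :=
  BooleanSubalgebra.closure (Set.range fun h : OpenElt A => (incl h, h.1))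

theorem incl_mem_skeletonGraph (h : OpenElt A) : (incl h, h.1) ∈ skeletonGraph A :=
  BooleanSubalgebra.subset_closure ⟨h, rfl⟩

/-- This makes the relation single-valued and injective. Every member is a finite join of
differences of generators, and a difference vanishes exactly when the two open elements are
comparable, a condition which is the same in both coordinates. -/
theorem eq_bot_iff_of_mem_skeletonGraph {x : FreeBoolExt (OpenElt A) × A}
    (hx : x ∈ skeletonGraph A) : x.1 = ⊥ ↔ x.2 = ⊥ := by
  have hs : IsSublattice (Set.range fun h : OpenElt A => (incl h, h.1)) := by
    constructor
    · rintro _ ⟨a, rfl⟩ _ ⟨b, rfl⟩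
      exact ⟨a ⊔ b, Prod.ext (incl_sup a b) rfl⟩
    · rintro _ ⟨a, rfl⟩ _ ⟨b, rfl⟩
      exact ⟨a ⊓ b, Prod.ext (incl_inf a b) rfl⟩
  refine BooleanSubalgebra.closure_sdiff_sup_induction
    (p := fun x _ => x.1 = ⊥ ↔ x.2 = ⊥) hs ⟨⊥, Prod.ext incl_bot rfl⟩ ⟨⊤, Prod.ext incl_top rfl⟩
    ?_ ?_ x hx
  · rintro _ ⟨a, rfl⟩ _ ⟨b, rfl⟩
    change incl a \ incl b = ⊥ ↔ a.1 \ b.1 = ⊥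
    rw [sdiff_eq_bot_iff, sdiff_eq_bot_iff, incl_le_incl]
    rfl
  · intro x _ y _ h₁ h₂
    change x.1 ⊔ y.1 = ⊥ ↔ x.2 ⊔ y.2 = ⊥
    rw [sup_eq_bot_iff, sup_eq_bot_iff, h₁, h₂]

theorem le_iff_of_mem_skeletonGraph {x y : FreeBoolExt (OpenElt A) × A}
    (hx : x ∈ skeletonGraph A) (hy : y ∈ skeletonGraph A) : x.1 ≤ y.1 ↔ x.2 ≤ y.2 := by
  rw [← sdiff_eq_bot_iff, ← sdiff_eq_bot_iff]
  exact eq_bot_iff_of_mem_skeletonGraph (BooleanSubalgebra.sdiff_mem hx hy)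

theorem exists_mem_skeletonGraph (x : FreeBoolExt (OpenElt A)) :
    ∃ a : A, (x, a) ∈ skeletonGraph A := by
  induction x using sup_sdiff_induction with
  | sdiff a b =>
    exact ⟨a.1 \ b.1, BooleanSubalgebra.sdiff_mem (incl_mem_skeletonGraph a)
      (incl_mem_skeletonGraph b)⟩
  | sup x y hx hy =>
    obtain ⟨a, ha⟩ := hx
    obtain ⟨b, hb⟩ := hy
    exact ⟨a ⊔ b, BooleanSubalgebra.sup_mem ha hb⟩

/-- The embedding of `σρA` in `A`. -/
noncomputable def toTense (x : FreeBoolExt (OpenElt A)) : A := (exists_mem_skeletonGraph x).choose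

theorem mk_toTense_mem (x : FreeBoolExt (OpenElt A)) : (x, toTense x) ∈ skeletonGraph A :=
  (exists_mem_skeletonGraph x).choose_spec

theorem toTense_le_toTense {x y : FreeBoolExt (OpenElt A)} : toTense x ≤ toTense y ↔ x ≤ y :=
  (le_iff_of_mem_skeletonGraph (mk_toTense_mem x) (mk_toTense_mem y)).symm

theorem toTense_injective : Function.Injective (toTense (A := A)) := fun _ _ h =>
  le_antisymm (toTense_le_toTense.1 h.le) (toTense_le_toTense.1 h.ge)

theorem toTense_eq_of_mem {x : FreeBoolExt (OpenElt A)} {a : A} (h : (x, a) ∈ skeletonGraph A) :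
    toTense x = a :=
  le_antisymm ((le_iff_of_mem_skeletonGraph (mk_toTense_mem x) h).1 le_rfl)
    ((le_iff_of_mem_skeletonGraph h (mk_toTense_mem x)).1 le_rfl)

theorem toTense_incl (h : OpenElt A) : toTense (incl h) = h.1 :=
  toTense_eq_of_mem (incl_mem_skeletonGraph h)

theorem toTense_bot : toTense (⊥ : FreeBoolExt (OpenElt A)) = ⊥ :=
  toTense_eq_of_mem BooleanSubalgebra.bot_mem

theorem toTense_top : toTense (⊤ : FreeBoolExt (OpenElt A)) = ⊤ :=
  toTense_eq_of_mem BooleanSubalgebra.top_mem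

theorem toTense_inf (x y : FreeBoolExt (OpenElt A)) : toTense (x ⊓ y) = toTense x ⊓ toTense y :=
  toTense_eq_of_mem (BooleanSubalgebra.inf_mem (mk_toTense_mem x) (mk_toTense_mem y))

theorem toTense_sup (x y : FreeBoolExt (OpenElt A)) : toTense (x ⊔ y) = toTense x ⊔ toTense y :=
  toTense_eq_of_mem (BooleanSubalgebra.sup_mem (mk_toTense_mem x) (mk_toTense_mem y))

theorem toTense_compl (x : FreeBoolExt (OpenElt A)) : toTense xᶜ = (toTense x)ᶜ :=
  toTense_eq_of_mem (BooleanSubalgebra.compl_mem (mk_toTense_mem x))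

theorem toTense_boxF (x : FreeBoolExt (OpenElt A)) : toTense (boxF x) = boxF (toTense x) := by
  change toTense (incl (interior x)) = _
  refine le_antisymm ?_ ?_
  · have h := toTense_le_toTense.2 (incl_interior_le x)
    rw [toTense_incl] at h ⊢
    exact (interior x).2.ge.trans (TenseAlgebra.boxF_mono h)
  -- The interior taken in `A` is itself an open element, so it lies in the image and competes in
  -- the join defining the interior in `B(O(A))`.
  · let b : OpenElt A := ⟨boxF (toTense x), TenseAlgebra.boxF_boxF _⟩
    rw [show boxF (toTense x) = toTense (incl b) from (toTense_incl b).symm, toTense_le_toTense,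
      incl_le_incl, le_interior_iff, ← toTense_le_toTense, toTense_incl]
    exact TenseAlgebra.boxF_le _

theorem toTense_diaP (x : FreeBoolExt (OpenElt A)) : toTense (diaP x) = diaP (toTense x) := by
  change toTense (incl (hull x)) = _
  refine le_antisymm ?_ ?_
  · let b : OpenElt A := ⟨diaP (toTense x), TenseAlgebra.boxF_diaP _⟩
    rw [show diaP (toTense x) = toTense (incl b) from (toTense_incl b).symm, toTense_le_toTense,
      incl_le_incl, hull_le_iff, ← toTense_le_toTense, toTense_incl]
    exact TenseAlgebra.le_diaP _
  · have h := toTense_le_toTense.2 (le_incl_hull x)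
    rw [toTense_incl] at h ⊢
    exact (TenseAlgebra.diaP_mono h).trans
      (TenseAlgebra.boxF_eq_self_iff_diaP.1 (hull x).2).le

variable (A) in
theorem locallyEmbeds : LocallyEmbeds (FreeBoolExt (OpenElt A)) A := fun _ _ =>
  ⟨toTense,
    { map_bot := toTense_bot
      map_top := toTense_top
      map_inf := fun x _ y _ => toTense_inf x y
      map_sup := fun x _ y _ => toTense_sup x y
      map_compl := fun x _ => toTense_compl x
      map_boxF := fun x _ => toTense_boxF x
      map_diaP := fun x _ => toTense_diaP x
      injOn := toTense_injective.injOn }⟩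

end FreeBoolExt

/-! ## Finite partitions in Boolean algebras -/

section Partition

/-- Every part of `P` lies below `a` or is disjoint from it. -/
def Decides {A : Type*} [BooleanAlgebra A] (P : Finset A) (a : A) : Prop :=
  ∀ p ∈ P, p ≤ a ∨ Disjoint p a

theorem Decides.compl {A : Type*} [BooleanAlgebra A] {P : Finset A} {a : A} (ha : Decides P a) :
    Decides P aᶜ := fun p hp =>
  (ha p hp).symm.imp le_compl_iff_disjoint_right.2 fun h => disjoint_compl_right.mono_left h

/-- A decided element is the join of the parts below it. -/
theorem Decides.le_of_forall_part {A : Type*} [BooleanAlgebra A] {P : Finset A} {a b : A}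
    (ha : Decides P a) (htop : P.sup id = ⊤) (h : ∀ p ∈ P, p ≤ a → p ≤ b) : a ≤ b := by
  rw [← top_inf_eq a, ← htop, Finset.sup_inf_distrib_right]
  refine Finset.sup_le fun p hp => ?_
  rcases ha p hp with hpa | hpa
  · exact inf_le_left.trans (h p hp hpa)
  · rw [id, hpa.eq_bot]
    exact bot_le

/-- Finitely many elements of a Boolean algebra are decided by the parts of a finite partition. -/
theorem exists_finset_partition_decides {A : Type*} [BooleanAlgebra A] {F : Set A}
    (hF : F.Finite) : ∃ P : Finset A, ⊥ ∉ P ∧ (P : Set A).PairwiseDisjoint id ∧ P.sup id = ⊤ ∧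
      ∀ a ∈ F, Decides P a := by
  classical
  suffices h : ∃ P : Finset A, (P : Set A).PairwiseDisjoint id ∧ P.sup id = ⊤ ∧
      ∀ a ∈ F, Decides P a by
    obtain ⟨P, hP, htop, hdec⟩ := h
    exact ⟨P.erase ⊥, Finset.notMem_erase ⊥ P, hP.subset (Finset.erase_subset _ _),
      (Finset.sup_erase_bot P).trans htop, fun a ha p hp => hdec a ha p (Finset.mem_of_mem_erase hp)⟩
  induction F, hF using Set.Finite.induction_on with
  | empty => exact ⟨{⊤}, by simp, by simp, by simp⟩
  | @insert a F _ _ ih =>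
    obtain ⟨P, hP, htop, hdec⟩ := ih
    -- Each part is cut in two by `a`; empty pieces may arise, which is why `⊥` is erased only at
    -- the end.
    refine ⟨P.image (· ⊓ a) ∪ P.image (· ⊓ aᶜ), ?_, ?_, ?_⟩
    · intro x hx y hy hxy
      simp only [Finset.coe_union, Finset.coe_image, Set.mem_union, Set.mem_image,
        Finset.mem_coe] at hx hy
      have hd : Disjoint a aᶜ := disjoint_compl_right
      rcases hx with ⟨p, hp, rfl⟩ | ⟨p, hp, rfl⟩ <;> rcases hy with ⟨q, hq, rfl⟩ | ⟨q, hq, rfl⟩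
      · exact (hP hp hq fun h => hxy (by rw [h])).mono inf_le_left inf_le_left
      · exact hd.mono inf_le_right inf_le_right
      · exact hd.symm.mono inf_le_right inf_le_right
      · exact (hP hp hq fun h => hxy (by rw [h])).mono inf_le_left inf_le_left
    · rw [Finset.sup_union, Finset.sup_image, Finset.sup_image, ← Finset.sup_sup, ← htop]
      exact Finset.sup_congr rfl fun p _ => sup_inf_inf_compl
    · rintro b (rfl | hb) x hx
      · rcases Finset.mem_union.1 hx with hx | hx <;> obtain ⟨p, -, rfl⟩ := Finset.mem_image.1 hx
        · exact Or.inl inf_le_right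
        · exact Or.inr (disjoint_compl_left.mono_left inf_le_right)
      · rcases Finset.mem_union.1 hx with hx | hx <;> obtain ⟨p, hp, rfl⟩ := Finset.mem_image.1 hx
        · exact (hdec b hb p hp).imp inf_le_left.trans fun h => h.mono_left inf_le_left
        · exact (hdec b hb p hp).imp inf_le_left.trans fun h => h.mono_left inf_le_left

/-- Between a disjoint family `c` and a family `e` above it there is a disjoint family with the
same join as `e`. -/
theorem exists_pairwiseDisjoint_between {ι B : Type*} [BooleanAlgebra B] (P : Finset ι)
    (c e : ι → B) (hce : ∀ i ∈ P, c i ≤ e i) (hc : (P : Set ι).PairwiseDisjoint c) :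
    ∃ d : ι → B, (∀ i ∈ P, c i ≤ d i ∧ d i ≤ e i) ∧ (P : Set ι).PairwiseDisjoint d ∧
      P.sup d = P.sup e := by
  classical
  induction P using Finset.induction_on with
  | empty => exact ⟨c, by simp, by simp, rfl⟩
  | @insert i P hi ih =>
    obtain ⟨d, hd, hdisj, hsup⟩ := ih (fun j hj => hce j (Finset.mem_insert_of_mem hj))
      (hc.subset (by simp))
    have hne : ∀ j ∈ P, j ≠ i := fun j hj h => hi (h ▸ hj)
    -- The new member takes its mandatory `c i` away from the others and otherwise only what they
    -- leave uncovered. The others keep their own `c j`, which are disjoint from `c i`.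
    let d' : ι → B := fun j => if j = i then c i ⊔ (e i \ P.sup d) else d j \ c i
    have hdi : d' i = c i ⊔ (e i \ P.sup d) := if_pos rfl
    have hdP : ∀ j ∈ P, d' j = d j \ c i := fun j hj => if_neg (hne j hj)
    have key : ∀ j ∈ P, Disjoint (d' i) (d' j) := fun j hj => by
      rw [hdi, hdP j hj, disjoint_sup_left]
      exact ⟨disjoint_sdiff_self_right, disjoint_sdiff_self_left.mono_right
        (sdiff_le.trans (Finset.le_sup hj))⟩
    refine ⟨d', ?_, ?_, ?_⟩
    · intro j hj
      rcases Finset.mem_insert.1 hj with rfl | hj'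
      · rw [hdi]
        exact ⟨le_sup_left, sup_le (hce j hj) sdiff_le⟩
      · rw [hdP j hj']
        exact ⟨le_sdiff.2 ⟨(hd j hj').1, hc hj (Finset.mem_insert_self i P) (hne j hj')⟩,
          sdiff_le.trans (hd j hj').2⟩
    · intro j hj k hk hjk
      rcases Finset.mem_insert.1 hj with rfl | hj' <;> rcases Finset.mem_insert.1 hk with rfl | hk'
      · exact (hjk rfl).elim
      · exact key k hk'
      · exact (key j hj').symm
      · change Disjoint (d' j) (d' k)
        rw [hdP j hj', hdP k hk']
        exact (hdisj hj' hk' hjk).mono sdiff_le sdiff_le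
    · rw [Finset.sup_insert, Finset.sup_insert, hdi, Finset.sup_congr rfl hdP]
      have : (P.sup fun j => d j \ c i) = P.sup d \ c i := (Finset.sup_sdiff_right P d (c i))
      rw [this, ← hsup, sup_assoc, sup_comm, sup_assoc, sdiff_sup_self, ← sup_assoc,
        sdiff_sup_self, sup_assoc, sup_comm (P.sup d), ← sup_assoc,
        sup_eq_left.2 (hce i (Finset.mem_insert_self i P))]

end Partition

/-! ## The map induced by a family indexed by a partition -/

section SupMap

open scoped Classical in
/-- The map sending a union of parts of `P` to the union of the corresponding members of `d`. -/
noncomputable def supMap {A B : Type*} [LE A] [SemilatticeSup B] [OrderBot B] (P : Finset A)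
    (d : A → B) (a : A) : B :=
  (P.filter (· ≤ a)).sup d

variable {A B : Type*} [BooleanAlgebra A] [BooleanAlgebra B] {P : Finset A} {d : A → B} {a b : A}

theorem le_supMap {p : A} (hp : p ∈ P) (hpa : p ≤ a) : d p ≤ supMap P d a := by
  classical
  exact Finset.le_sup (Finset.mem_filter.2 ⟨hp, hpa⟩)

theorem supMap_le_iff {x : B} : supMap P d a ≤ x ↔ ∀ p ∈ P, p ≤ a → d p ≤ x := by
  classical
  simp only [supMap, Finset.sup_le_iff, Finset.mem_filter, and_imp]

theorem supMap_mono (h : a ≤ b) : supMap P d a ≤ supMap P d b :=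
  supMap_le_iff.2 fun _ hp hpa => le_supMap hp (hpa.trans h)

theorem supMap_top (hd : P.sup d = ⊤) : supMap P d ⊤ = ⊤ :=
  top_le_iff.1 (hd ▸ Finset.sup_le fun _ hp => le_supMap hp le_top)

theorem supMap_sup (ha : Decides P a) : supMap P d (a ⊔ b) = supMap P d a ⊔ supMap P d b := by
  refine le_antisymm (supMap_le_iff.2 fun p hp hpab => ?_)
    (sup_le (supMap_mono le_sup_left) (supMap_mono le_sup_right))
  rcases ha p hp with h | h
  · exact (le_supMap hp h).trans le_sup_left
  · exact (le_supMap hp (h.left_le_of_le_sup_left hpab)).trans le_sup_right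

/-- A nonzero part disjoint from `a` is none of the parts below `a`. -/
theorem disjoint_supMap (hbot : ⊥ ∉ P) (hP : (P : Set A).PairwiseDisjoint d) {p : A}
    (hp : p ∈ P) (hpa : Disjoint p a) : Disjoint (d p) (supMap P d a) := by
  classical
  rw [supMap, Finset.disjoint_sup_right]
  intro q hq
  obtain ⟨hq, hqa⟩ := Finset.mem_filter.1 hq
  by_cases h : p = q
  · subst h
    exact (hbot (disjoint_self.1 (hpa.mono_right hqa) ▸ hp)).elim
  · exact hP hp hq h

theorem supMap_bot (hbot : ⊥ ∉ P) : supMap P d ⊥ = ⊥ :=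
  le_bot_iff.1 (supMap_le_iff.2 fun _ hp h => (hbot (le_bot_iff.1 h ▸ hp)).elim)

theorem supMap_compl (hbot : ⊥ ∉ P) (hP : (P : Set A).PairwiseDisjoint d) (hd : P.sup d = ⊤)
    (ha : Decides P a) : supMap P d aᶜ = (supMap P d a)ᶜ := by
  refine (IsCompl.of_eq ?_ ?_).eq_compl
  · refine disjoint_iff.1 ?_
    classical
    rw [supMap, Finset.disjoint_sup_left]
    intro p hp
    obtain ⟨hp, hpa⟩ := Finset.mem_filter.1 hp
    exact disjoint_supMap hbot hP hp (le_compl_iff_disjoint_right.1 hpa)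
  · rw [sup_comm, ← supMap_sup ha, sup_compl_eq_top, supMap_top hd]

theorem supMap_inf (hbot : ⊥ ∉ P) (hP : (P : Set A).PairwiseDisjoint d) (hd : P.sup d = ⊤)
    (ha : Decides P a) : supMap P d (a ⊓ b) = supMap P d a ⊓ supMap P d b := by
  refine le_antisymm (le_inf (supMap_mono inf_le_left) (supMap_mono inf_le_right)) ?_
  -- Applying the monotone map to this inequality reduces meets to joins and complements, with only
  -- `a` required to be decided.
  have h : b ≤ (a ⊓ b) ⊔ aᶜ := by rw [sup_inf_right, sup_compl_eq_top, top_inf_eq]; exact le_sup_left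
  have := supMap_mono (P := P) (d := d) h
  rw [sup_comm, supMap_sup ha.compl, supMap_compl hbot hP hd ha] at this
  rw [inf_comm, ← le_himp_iff, himp_eq, sup_comm]
  exact this

end SupMap

/-! ## Passive parts -/

section Passive

variable {A : Type u} [TenseAlgebra A]

/-- `□_F a` as an open element. -/
def OpenElt.box (a : A) : OpenElt A := ⟨boxF a, TenseAlgebra.boxF_boxF a⟩

/-- `◇_P a` as an open element. -/
def OpenElt.dia (a : A) : OpenElt A := ⟨diaP a, TenseAlgebra.boxF_diaP a⟩

theorem FreeBoolExt.toTense_incl_box (a : A) : (incl (OpenElt.box a)).toTense = boxF a :=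
  toTense_incl _

theorem FreeBoolExt.toTense_incl_dia (a : A) : (incl (OpenElt.dia a)).toTense = diaP a :=
  toTense_incl _

/-- The points of `p` from which `p` cannot be left upwards and then be entered again, and the
same downwards. -/
def core (p : A) : A := p ⊓ boxF (p ⊔ boxF pᶜ) ⊔ p ⊓ (diaP (diaP p ⊓ pᶜ))ᶜ

theorem core_le (p : A) : core p ≤ p := sup_le inf_le_left inf_le_left

-- In the two halves of `core p` the factor `p` can be replaced by `(□_F pᶜ)ᶜ` and by `◇_P p`
-- respectively. Indeed `□_F (p ⊔ □_F pᶜ)` lies below `p ⊔ □_F pᶜ`, and `◇_P p ⊓ pᶜ` lies below its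
-- own `◇_P`. What remains is a Boolean combination of open elements.
open TenseAlgebra FreeBoolExt in
theorem exists_toTense_eq_core (p : A) : ∃ x : FreeBoolExt (OpenElt A), x.toTense = core p := by
  refine ⟨incl (OpenElt.box (p ⊔ boxF pᶜ)) ⊓ (incl (OpenElt.box pᶜ))ᶜ ⊔
    incl (OpenElt.dia p) ⊓ (incl (OpenElt.dia (diaP p ⊓ pᶜ)))ᶜ, ?_⟩
  simp only [toTense_sup, toTense_inf, toTense_compl, toTense_incl_box, toTense_incl_dia]
  refine congrArg₂ _ (le_antisymm ?_ ?_) (le_antisymm ?_ ?_)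
  · refine le_inf ?_ inf_le_left
    rw [← sdiff_eq, sdiff_le_iff, sup_comm]
    exact boxF_le _
  · exact le_inf inf_le_right (inf_le_left.trans (le_compl_comm.1 (boxF_le _)))
  · refine le_inf ?_ inf_le_right
    rw [← sdiff_eq, sdiff_le_iff, sup_comm, ← sdiff_le_iff, sdiff_eq]
    exact le_diaP _
  · exact inf_le_inf_right _ (le_diaP p)

end Passive

/-- The first Grzegorczyk axiom at `pᶜ` gives this already for the first half of `core p`. -/
theorem boxF_compl_core_le {A : Ten.{u}} (hA : A ∈ GRZT) (p : A) : boxF (core p)ᶜ ≤ pᶜ := by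
  refine (TenseAlgebra.boxF_mono ?_).trans (hA pᶜ).1
  rw [compl_compl, sup_comm, ← compl_inf]
  exact compl_le_compl le_sup_left

/-- The second half of `core p` is exactly the argument of `◇_P` in the second Grzegorczyk axiom. -/
theorem le_diaP_core {A : Ten.{u}} (hA : A ∈ GRZT) (p : A) : p ≤ diaP (core p) :=
  (hA p).2.trans (TenseAlgebra.diaP_mono le_sup_right)

/-! ## Local embeddings into the skeleton -/

section Skeleton

open FreeBoolExt

/-- The witness is the meet of all `u ∈ O` above `p` and all complements of those disjoint from `p`.
It remembers every relation of `p` to `O` that the partition decides. -/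
theorem exists_le_toTense_separating {A : Type u} [TenseAlgebra A] {O : Set (OpenElt A)}
    (hO : O.Finite) (p : A) : ∃ x : FreeBoolExt (OpenElt A), p ≤ toTense x ∧
      ∀ u ∈ O, (p ≤ u.1 → x ≤ incl u) ∧ (Disjoint p u.1 → x ≤ (incl u)ᶜ) := by
  induction O, hO using Set.Finite.induction_on with
  | empty => exact ⟨⊤, by rw [toTense_top]; exact le_top, by simp⟩
  | @insert u O _ _ ih =>
    obtain ⟨x, hpx, hx⟩ := ih
    have h : ∃ y : FreeBoolExt (OpenElt A), p ≤ toTense y ∧ (p ≤ u.1 → y ≤ incl u) ∧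
        (Disjoint p u.1 → y ≤ (incl u)ᶜ) := by
      by_cases h₁ : Disjoint p u.1
      · by_cases h₂ : p ≤ u.1
        · refine ⟨⊥, ?_, fun _ => bot_le, fun _ => bot_le⟩
          rw [disjoint_self.1 (h₁.mono_right h₂)]
          exact bot_le
        · refine ⟨(incl u)ᶜ, ?_, fun h => (h₂ h).elim, fun _ => le_rfl⟩
          rw [toTense_compl, toTense_incl]
          exact le_compl_iff_disjoint_right.2 h₁
      · by_cases h₂ : p ≤ u.1
        · exact ⟨incl u, by rwa [toTense_incl], fun _ => le_rfl, fun h => (h₁ h).elim⟩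
        · exact ⟨⊤, by rw [toTense_top]; exact le_top, fun h => (h₂ h).elim, fun h => (h₁ h).elim⟩
    obtain ⟨y, hpy, hy₁, hy₂⟩ := h
    refine ⟨x ⊓ y, by rw [toTense_inf]; exact le_inf hpx hpy, ?_⟩
    rintro w (rfl | hw)
    · exact ⟨fun h => inf_le_right.trans (hy₁ h), fun h => inf_le_right.trans (hy₂ h)⟩
    · exact ⟨fun h => inf_le_left.trans ((hx w hw).1 h), fun h => inf_le_left.trans ((hx w hw).2 h)⟩

theorem supMap_eq_incl {A : Type u} [TenseAlgebra A] {P : Finset A}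
    {d : A → FreeBoolExt (OpenElt A)} (hd : P.sup d = ⊤) {u : OpenElt A} (hu : Decides P u.1)
    (h₁ : ∀ p ∈ P, p ≤ u.1 → d p ≤ incl u) (h₂ : ∀ p ∈ P, Disjoint p u.1 → d p ≤ (incl u)ᶜ) :
    supMap P d u.1 = incl u := by
  refine le_antisymm (supMap_le_iff.2 h₁) ?_
  rw [← sup_compl_eq_top (x := incl u)] at hd
  have : P.sup d ≤ supMap P d u.1 ⊔ (incl u)ᶜ := by
    refine Finset.sup_le fun p hp => ?_
    rcases hu p hp with h | h
    · exact (le_supMap hp h).trans le_sup_left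
    · exact (h₂ p hp h).trans le_sup_right
  rw [hd] at this
  exact disjoint_compl_right.left_le_of_le_sup_right (le_sup_left.trans this)

variable {A : Ten.{u}}

/-- If the parts of a family indexed by a finite partition contain the cores of the partition, the
induced map commutes with `□_F` wherever it fixes the value of `□_F`. -/
theorem supMap_boxF (hA : A ∈ GRZT) {P : Finset A} {d : A → FreeBoolExt (OpenElt A)}
    (hbot : ⊥ ∉ P) (htop : P.sup id = ⊤) (hP : (P : Set A).PairwiseDisjoint d)
    (hcore : ∀ p ∈ P, core p ≤ toTense (d p)) {a : A} (ha : Decides P a)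
    (h : supMap P d (boxF a) = incl (OpenElt.box a)) :
    supMap P d (boxF a) = boxF (supMap P d a) := by
  rw [h]
  refine le_antisymm ?_ ?_
  · refine incl_le_incl.2 (le_interior_iff.2 ?_)
    rw [← h]
    exact supMap_mono (TenseAlgebra.boxF_le a)
  · rw [← toTense_le_toTense, toTense_incl_box, toTense_boxF, ← TenseAlgebra.boxF_boxF]
    refine TenseAlgebra.boxF_mono ?_
    -- It remains to see that no part `p` outside `a` meets the interior of the image of `a`. The
    -- image avoids `d p`, hence `core p`, and an open element avoiding `core p` avoids `p`.
    rw [← compl_le_compl_iff_le]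
    refine ha.compl.le_of_forall_part htop fun p hp hpa => ?_
    refine le_compl_comm.1 ((TenseAlgebra.boxF_mono ?_).trans (boxF_compl_core_le hA p))
    refine le_compl_comm.1 ((hcore p hp).trans ?_)
    rw [← toTense_compl, toTense_le_toTense]
    exact le_compl_iff_disjoint_right.2
      (disjoint_supMap hbot hP hp (le_compl_iff_disjoint_right.1 hpa))

theorem supMap_diaP (hA : A ∈ GRZT) {P : Finset A} {d : A → FreeBoolExt (OpenElt A)}
    (htop : P.sup id = ⊤) (hcore : ∀ p ∈ P, core p ≤ toTense (d p)) {a : A} (ha : Decides P a)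
    (h : supMap P d (diaP a) = incl (OpenElt.dia a)) :
    supMap P d (diaP a) = diaP (supMap P d a) := by
  rw [h]
  refine le_antisymm ?_ ?_
  · rw [← toTense_le_toTense, toTense_incl_dia, toTense_diaP]
    refine (TenseAlgebra.diaP_mono ?_).trans (TenseAlgebra.diaP_diaP_le _)
    -- Each part `p` below `a` lies in `◇_P (core p)`, and `core p` is contained in the image of
    -- `a`.
    refine ha.le_of_forall_part htop fun p hp hpa => ?_
    refine (le_diaP_core hA p).trans (TenseAlgebra.diaP_mono ?_)
    exact (hcore p hp).trans (toTense_le_toTense.2 (le_supMap hp hpa))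
  · refine incl_le_incl.2 (hull_le_iff.2 ?_)
    rw [← h]
    exact supMap_mono (TenseAlgebra.le_diaP a)

/-- A part below `a` and disjoint from `b` would have `d p = ⊥`, hence an empty core, and a part
with empty core is itself empty by `le_diaP_core`. -/
theorem le_of_supMap_le (hA : A ∈ GRZT) {P : Finset A} {d : A → FreeBoolExt (OpenElt A)}
    (hbot : ⊥ ∉ P) (htop : P.sup id = ⊤) (hP : (P : Set A).PairwiseDisjoint d)
    (hcore : ∀ p ∈ P, core p ≤ toTense (d p)) {a b : A} (ha : Decides P a) (hb : Decides P b)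
    (h : supMap P d a ≤ supMap P d b) : a ≤ b := by
  refine ha.le_of_forall_part htop fun p hp hpa => (hb p hp).resolve_right fun hpb => ?_
  have hdp : d p = ⊥ :=
    disjoint_self.1 ((disjoint_supMap hbot hP hp hpb).mono_right ((le_supMap hp hpa).trans h))
  have hc := hcore p hp
  rw [hdp, toTense_bot, le_bot_iff] at hc
  have hp' := le_diaP_core hA p
  rw [hc, TenseAlgebra.diaP_bot, le_bot_iff] at hp'
  exact hbot (hp' ▸ hp)

theorem locallyEmbeds_skeleton (hA : A ∈ GRZT) : LocallyEmbeds A (FreeBoolExt (OpenElt A)) := by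
  intro F hF
  -- The values of `□_F` and `◇_P` on `F` must be decided too, since the map is to fix them.
  obtain ⟨P, hbot, hPd, htop, hdec⟩ := exists_finset_partition_decides
    (hF.union ((hF.image boxF).union (hF.image diaP)))
  have hO : (OpenElt.box '' F ∪ OpenElt.dia '' F).Finite := (hF.image _).union (hF.image _)
  choose e hpe he using fun p : A => exists_le_toTense_separating hO p
  choose c hc using fun p : A => exists_toTense_eq_core p
  obtain ⟨d, hd, hP, hsup⟩ := exists_pairwiseDisjoint_between P c e
    (fun p _ => by
      rw [← toTense_le_toTense, hc]
      exact (core_le p).trans (hpe p))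
    -- Distinct cores are disjoint because they lie in distinct parts; injectivity of `toTense`
    -- carries this to the skeleton.
    (fun p hp q hq hpq => by
      change Disjoint (c p) (c q)
      rw [disjoint_iff, ← toTense_injective.eq_iff, toTense_inf, toTense_bot, hc, hc,
        ← disjoint_iff]
      exact (hPd hp hq hpq).mono (core_le p) (core_le q))
  have hdtop : P.sup d = ⊤ := by
    rw [hsup, ← top_le_iff, ← toTense_le_toTense, toTense_top, ← htop]
    exact Finset.sup_le fun p hp => (hpe p).trans (toTense_le_toTense.2 (Finset.le_sup hp))
  have hcore : ∀ p ∈ P, core p ≤ toTense (d p) := fun p hp => by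
    rw [← hc, toTense_le_toTense]
    exact (hd p hp).1
  have hfix : ∀ u ∈ OpenElt.box '' F ∪ OpenElt.dia '' F, Decides P u.1 →
      supMap P d u.1 = incl u := fun u hu hdu =>
    supMap_eq_incl hdtop hdu (fun p hp h => (hd p hp).2.trans ((he p u hu).1 h))
      fun p hp h => (hd p hp).2.trans ((he p u hu).2 h)
  have hF' : ∀ a ∈ F, Decides P a := fun a ha => hdec a (Or.inl ha)
  refine ⟨supMap P d, supMap_bot hbot, supMap_top hdtop,
    fun a ha b _ => supMap_inf hbot hP hdtop (hF' a ha), fun a ha b _ => supMap_sup (hF' a ha),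
    fun a ha => supMap_compl hbot hP hdtop (hF' a ha), fun a ha => ?_, fun a ha => ?_,
    fun a ha b hb hab => le_antisymm ?_ ?_⟩
  · exact supMap_boxF hA hbot htop hP hcore (hF' a ha)
      (hfix (OpenElt.box a) (Or.inl ⟨a, ha, rfl⟩) (hdec _ (Or.inr (Or.inl ⟨a, ha, rfl⟩))))
  · exact supMap_diaP hA htop hcore (hF' a ha)
      (hfix (OpenElt.dia a) (Or.inr ⟨a, ha, rfl⟩) (hdec _ (Or.inr (Or.inr ⟨a, ha, rfl⟩))))
  · exact le_of_supMap_le hA hbot htop hP hcore (hF' a ha) (hF' b hb) hab.le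
  · exact le_of_supMap_le hA hbot htop hP hcore (hF' b hb) (hF' a ha) hab.ge

end Skeleton

/-- Validity of tense rules on an algebra in `GRZ.T` and on its skeleton `σρA` coincide; and every
universal class `U` of `GRZ.T`-algebras is generated by its skeletal elements: `U = σρU`. -/
theorem mainTheorem9 :
    (∀ A : Ten.{u}, A ∈ GRZT → ∀ r : TenseRule, r.ValidOn A ↔ r.ValidOn (sigma (rho A))) ∧
    (∀ U : Set Ten.{u}, IsUniversalClass U → U ⊆ GRZT → U = sigmaClass (rhoClass U)) := by
  have hsub (A : Ten.{u}) : LocallyEmbeds (sigma (rho A)) A := FreeBoolExt.locallyEmbeds A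
  have hsup (A : Ten.{u}) (hA : A ∈ GRZT) : LocallyEmbeds A (sigma (rho A)) :=
    locallyEmbeds_skeleton hA
  refine ⟨fun A hA r => ⟨(hsub A).validOn, (hsup A hA).validOn⟩, fun U hU hG => ?_⟩
  refine Set.Subset.antisymm ?_ ?_
  · rintro A hA _ ⟨⟨T, hT, rfl⟩, hK⟩
    exact (hsup A (hG hA)).models hT (hK ⟨rho A, ⟨A, hA, rfl⟩, rfl⟩)
  · refine Set.sInter_subset_of_mem ⟨hU, ?_⟩
    rintro _ ⟨_, ⟨A, hA, rfl⟩, rfl⟩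
    obtain ⟨T, hT, rfl⟩ := hU
    exact (hsub A).models hT hA
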